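/- Let $E,F$ be separable real Banach spaces with duals $E',F'$, let $(\Omega,\mathcal A,\mu)$ be a probability space, and let $X:\Omega\to E$ and $Y:\Omega\to F$ be jointly Gaussian random variables (that is, $\omega\mapsto(X(\omega),Y(\omega))$ is Gaussian: its image under every continuous linear functional on $E\times F$ is a real, possibly degenerate, Gaussian random variable) with $\mathbb E(X)=0$ and $\mathbb E(Y)=0$. Let $\sigma(Y)$ be the smallest $\sigma$-algebra for which all $f'(Y)$, $f'\in F'$, are measurable, write $\mathbb E(\,\cdot\,|Y):=\mathbb E(\,\cdot\,|\sigma(Y))$, and put $Z:=\mathbb E(X|Y)$. For a centred square integrable random variable $V$ with values in a Banach space $B$, the covariance operator $\mathrm{cov}(V):B'\to B$ is the bounded operator $\mathrm{cov}(V)b':=\mathbb E(b'(V)V)$ (Bochner integral). For $e_1,e_2\in E$ let $e_1\otimes e_2:E'\to E$ be the operator $e'\mapsto e'(e_1)e_2$, and let the injective tensor product $E\check\otimes E$ be realized as the closed linear span of these operators in the space of bounded operators $E'\to E$. The conditional variance of $X$ given $Y$ is the $E\check\otimes E$-valued conditional expectation $$\mathrm{cov}(X|Y):=\mathbb E\bigl((X-\mathbb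 E(X|Y))\otimes(X-\mathbb E(X|Y))\,\big|\,Y\bigr).$$ Then $X$, $Y$ and $Z$ are square integrable, and $\mu$-almost surely, as an equality of operators $E'\to E$, $$\mathrm{cov}(X|Y)=\mathrm{cov}(X)-\mathrm{cov}(Z).$$ Moreover, for every bounded linear operator $M:F\to E$ with $MY=Z$ $\mu$-almost everywhere, $\mu$-almost surely $$\mathrm{cov}(X|Y)=\mathrm{cov}(X)-M\,\mathrm{cov}(Y)\,M',$$ where $M':E'\to F'$, $M'e'=e'\circ M$, is the dual operator. -/

import Mathlib

set_option maxSynthPendingDepth 3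

open MeasureTheory ProbabilityTheory TopologicalSpace

noncomputable section

namespace GaussCond

section Tensor

variable (E : Type*) [NormedAddCommGroup E] [NormedSpace ℝ E]

variable {E} in
/-- The elementary tensor `x ⊗ y`, as the operator `E' → E`, `e' ↦ e'(x) y`. -/
def elemTensor (x y : E) : StrongDual ℝ E →L[ℝ] E :=
  (ContinuousLinearMap.apply ℝ ℝ x).smulRight y

variable {E} in
theorem elemTensor_apply (x y : E) (e' : StrongDual ℝ E) :
    elemTensor x y e' = e' x • y := rfl

/-- The injective tensor product of `E` with itself: the closure of the linear span of the
elementary tensors in the operators `E' → E`. The operator norm of `∑ᵢ xᵢ ⊗ yᵢ` is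
`sup {|∑ᵢ e'(xᵢ) f'(yᵢ)| : ‖e'‖ ≤ 1, ‖f'‖ ≤ 1}`, which is its injective norm. -/
def injTensor : Submodule ℝ (StrongDual ℝ E →L[ℝ] E) :=
  (Submodule.span ℝ (Set.range fun p : E × E => elemTensor p.1 p.2)).topologicalClosure

variable {E} in
/-- The elementary tensor `x ⊗ y` as an element of the injective tensor product. -/
def tmul (x y : E) : injTensor E :=
  ⟨elemTensor x y, Submodule.le_topologicalClosure _ (Submodule.subset_span ⟨(x, y), rfl⟩)⟩

instance [CompleteSpace E] : CompleteSpace (injTensor E) :=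
  Submodule.topologicalClosure.completeSpace _

end Tensor

section Probability

variable {Ω E F : Type*} [MeasurableSpace Ω]
  [NormedAddCommGroup E] [NormedSpace ℝ E] [NormedAddCommGroup F] [NormedSpace ℝ F]

/-- `e'(X) X` is integrable when `X` is square integrable. -/
theorem integrable_dual_smul {X : Ω → E} {μ : Measure Ω} (hX : MemLp X 2 μ)
    (e' : StrongDual ℝ E) : Integrable (fun ω => e' (X ω) • X ω) μ :=
  memLp_one_iff_integrable.1 (hX.smul (hX.continuousLinearMap_comp e'))

/-- The covariance operator `cov(X) : E' → E`, `e' ↦ 𝔼(e'(X) X)`, of a (centred) square integrable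
random variable `X` (the integral is a Bochner integral). -/
def cov {X : Ω → E} {μ : Measure Ω} (hX : MemLp X 2 μ) : StrongDual ℝ E →L[ℝ] E :=
  LinearMap.mkContinuous
    { toFun := fun e' => ∫ ω, e' (X ω) • X ω ∂μ
      map_add' := fun e' f' => by
        rw [← integral_add (integrable_dual_smul hX e') (integrable_dual_smul hX f')]
        simp only [add_apply, add_smul]
      map_smul' := fun c e' => by
        rw [RingHom.id_apply, ← integral_smul]
        simp only [smul_apply, smul_eq_mul, mul_smul] }
    (∫ ω, ‖X ω‖ ^ 2 ∂μ)
    (fun e' => by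
      rw [mul_comm, ← integral_const_mul]
      refine norm_integral_le_of_norm_le ?_ (ae_of_all _ fun ω => ?_)
      · exact (hX.integrable_norm_pow (p := 2) two_ne_zero).const_mul _
      · rw [norm_smul, pow_two, ← mul_assoc]
        exact mul_le_mul_of_nonneg_right (e'.le_opNorm _) (norm_nonneg _))

theorem cov_apply {X : Ω → E} {μ : Measure Ω} (hX : MemLp X 2 μ) (e' : StrongDual ℝ E) :
    cov hX e' = ∫ ω, e' (X ω) • X ω ∂μ := rfl

/-- `σ(Y)`: the smallest σ-algebra on `Ω` for which `Y` is weakly measurable. -/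
@[reducible] def sigmaOf {Ω : Type*} (Y : Ω → F) : MeasurableSpace Ω :=
  ⨆ f' : StrongDual ℝ F, MeasurableSpace.comap (fun ω => f' (Y ω)) (borel ℝ)

/-- The conditional expectation `𝔼(X|Y) = 𝔼(X|σ(Y))`. -/
def condMean [CompleteSpace E] (X : Ω → E) (Y : Ω → F) (μ : Measure Ω) : Ω → E :=
  μ[X | sigmaOf Y]

/-- The conditional variance
`cov(X|Y) = 𝔼((X - 𝔼(X|Y)) ⊗ (X - 𝔼(X|Y)) | Y)`, a conditional expectation of a random variable
with values in the injective tensor product. -/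
def condCov [CompleteSpace E] (X : Ω → E) (Y : Ω → F) (μ : Measure Ω) : Ω → injTensor E :=
  condMean (fun ω => tmul (X ω - condMean X Y μ ω) (X ω - condMean X Y μ ω)) Y μ

end Probability

end GaussCond

end

open Filter Topology
open scoped RealInnerProductSpace ENNReal

namespace GaussCond

/-! ### Gaussian laws under mean square limits -/

section RealGaussian

variable {Ω : Type*} [MeasurableSpace Ω] {μ : Measure Ω} [IsProbabilityMeasure μ]

/-! Let `H` be the `L²`-closure of the variables `f'(Y)`, and split `e'(X)` into its projection on
`H` and a residual `r`. Mean square limits of Gaussians are Gaussian (`isClosed_hasGaussianLaw`), so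
`(r, Y)` is jointly Gaussian; being uncorrelated with every `f'(Y)`, `r` is independent of `Y`
(`indepFun_residual`). As `r` is centred, the projection is `e'(Z)` and `r = e'(X - Z)`
(`dual_condMean_ae_eq`).

By polarization each `e'(X - Z) f'(X - Z)` has constant conditional expectation, so `cov(X|Y)` is
the constant `𝔼((X - Z) ⊗ (X - Z))` (`condCov_ae_eq_const`). Orthogonality of projection and
residual evaluates it as `cov(X) - cov(Z)`, and `cov_comp` rewrites `cov(Z)` when `Z = MY`. -/

theorem integral_norm_le_norm_Lp_two (f : Lp ℝ 2 μ) : ∫ ω, ‖f ω‖ ∂μ ≤ ‖f‖ := by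
  rw [integral_norm_eq_lintegral_enorm (Lp.aestronglyMeasurable f), Lp.norm_def,
    ← eLpNorm_one_eq_lintegral_enorm]
  exact ENNReal.toReal_mono (Lp.eLpNorm_ne_top f)
    (eLpNorm_le_eLpNorm_of_exponent_le one_le_two (Lp.aestronglyMeasurable f))

theorem integrable_Lp_two (f : Lp ℝ 2 μ) : Integrable f μ :=
  (Lp.memLp f).integrable one_le_two

theorem norm_integral_exp_sub_le (t : ℝ) (f g : Lp ℝ 2 μ) :
    ‖∫ ω, Complex.exp (Complex.I * (t * f ω : ℝ)) ∂μ -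
      ∫ ω, Complex.exp (Complex.I * (t * g ω : ℝ)) ∂μ‖ ≤ |t| * ‖f - g‖ := by
  have hint : ∀ h : Lp ℝ 2 μ, Integrable (fun ω => Complex.exp (Complex.I * (t * h ω : ℝ))) μ := by
    intro h
    refine Integrable.of_bound (C := 1) ?_ (ae_of_all _ fun ω => ?_)
    · have := Lp.aestronglyMeasurable h
      exact (by fun_prop : Continuous fun x : ℝ =>
        Complex.exp (Complex.I * (t * x : ℝ))).comp_aestronglyMeasurable this
    · rw [mul_comm, Complex.norm_exp_ofReal_mul_I]
  rw [← integral_sub (hint f) (hint g)]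
  calc _ ≤ ∫ ω, |t| * ‖(f - g) ω‖ ∂μ := by
        refine norm_integral_le_of_norm_le ((integrable_Lp_two _).norm.const_mul _) ?_
        filter_upwards [Lp.coeFn_sub f g] with ω hω
        have h1 : Complex.exp (Complex.I * (t * f ω : ℝ)) - Complex.exp (Complex.I * (t * g ω : ℝ))
            = Complex.exp (Complex.I * (t * g ω : ℝ)) *
              (Complex.exp (Complex.I * (t * (f ω - g ω) : ℝ)) - 1) := by
          rw [mul_sub, ← Complex.exp_add]
          push_cast
          ring_nf
        rw [h1, norm_mul, mul_comm Complex.I, Complex.norm_exp_ofReal_mul_I, one_mul, hω,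
          Pi.sub_apply, ← Real.norm_eq_abs, ← norm_mul]
        exact Real.norm_exp_I_mul_ofReal_sub_one_le
    _ = |t| * ∫ ω, ‖(f - g) ω‖ ∂μ := integral_const_mul _ _
    _ ≤ _ := by gcongr; exact integral_norm_le_norm_Lp_two _

theorem continuous_integral_exp (t : ℝ) :
    Continuous fun f : Lp ℝ 2 μ => ∫ ω, Complex.exp (Complex.I * (t * f ω : ℝ)) ∂μ := by
  refine LipschitzWith.continuous (K := ‖t‖₊) (LipschitzWith.of_dist_le_mul fun f g => ?_)
  rw [dist_eq_norm, dist_eq_norm]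
  exact norm_integral_exp_sub_le t f g

theorem continuous_integral_Lp_two : Continuous fun f : Lp ℝ 2 μ => ∫ ω, f ω ∂μ := by
  refine LipschitzWith.continuous (K := 1) (LipschitzWith.of_dist_le_mul fun f g => ?_)
  rw [dist_eq_norm, dist_eq_norm, NNReal.coe_one, one_mul,
    ← integral_sub (integrable_Lp_two f) (integrable_Lp_two g)]
  refine le_trans ?_ (integral_norm_le_norm_Lp_two (f - g))
  refine norm_integral_le_of_norm_le (integrable_Lp_two _).norm ?_
  filter_upwards [Lp.coeFn_sub f g] with ω hω
  rw [hω, Pi.sub_apply]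

omit [IsProbabilityMeasure μ] in
theorem integral_sq_eq_norm_sq (f : Lp ℝ 2 μ) : ∫ ω, f ω ^ 2 ∂μ = ‖f‖ ^ 2 := by
  rw [← real_inner_self_eq_norm_sq, L2.inner_def]
  simp [pow_two]

/-- Both sides of the characteristic function identity are continuous in `f` for the `L²` norm, so
Gaussianity becomes a closed condition. -/
theorem hasGaussianLaw_Lp_iff (f : Lp ℝ 2 μ) :
    HasGaussianLaw f μ ↔ ∀ t : ℝ, ∫ ω, Complex.exp (Complex.I * (t * f ω : ℝ)) ∂μ =
      Complex.exp ((t * ∫ ω, f ω ∂μ : ℝ) * Complex.I -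
        (t ^ 2 * (‖f‖ ^ 2 - (∫ ω, f ω ∂μ) ^ 2) : ℝ) / 2) := by
  have hf : AEMeasurable f μ := (Lp.aestronglyMeasurable f).aemeasurable
  rw [hasGaussianLaw_iff_charFun_map_eq hf]
  refine forall_congr' fun t => ?_
  have h1 : charFun (μ.map f) t = ∫ ω, Complex.exp (Complex.I * (t * f ω : ℝ)) ∂μ := by
    rw [charFun_apply_real, integral_map hf (by fun_prop)]
    refine integral_congr_ae (ae_of_all _ fun ω => ?_)
    simp only [Complex.ofReal_mul]
    ring_nf
  have h2 : ∀ ω, ⟪t, f ω⟫ = t * f ω := fun ω => by simp [mul_comm]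
  simp_rw [h1, h2]
  rw [variance_const_mul, integral_const_mul, variance_eq_sub (Lp.memLp f)]
  simp_rw [Pi.pow_apply, integral_sq_eq_norm_sq]

/-- A mean square limit of real Gaussian random variables is Gaussian. -/
theorem isClosed_hasGaussianLaw : IsClosed {f : Lp ℝ 2 μ | HasGaussianLaw f μ} := by
  simp_rw [hasGaussianLaw_Lp_iff, Set.ofPred_forall]
  refine isClosed_iInter fun t => isClosed_eq (continuous_integral_exp t) ?_
  have := continuous_integral_Lp_two (μ := μ)
  fun_prop

end RealGaussian

/-! ### Closed subspaces of `L²` generated by a random vector -/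

section Projection

variable {Ω E F : Type*} [MeasurableSpace Ω] {μ : Measure Ω}
  [NormedAddCommGroup E] [NormedSpace ℝ E] [NormedAddCommGroup F] [NormedSpace ℝ F]

/-- The linear map `e' ↦ e'(X)` from the dual into the square integrable random variables. -/
noncomputable def dualLp {X : Ω → E} (hX : MemLp X 2 μ) : StrongDual ℝ E →ₗ[ℝ] Lp ℝ 2 μ where
  toFun e' := (hX.continuousLinearMap_comp e').toLp _
  map_add' _ _ := rfl
  map_smul' _ _ := rfl

theorem coeFn_dualLp {X : Ω → E} (hX : MemLp X 2 μ) (e' : StrongDual ℝ E) :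
    dualLp hX e' =ᵐ[μ] fun ω => e' (X ω) :=
  MemLp.coeFn_toLp (hX.continuousLinearMap_comp e')

/-- The closed subspace of `L²` generated by the `f'(Y)`. -/
noncomputable def dualSpan {Y : Ω → F} (hY : MemLp Y 2 μ) : Submodule ℝ (Lp ℝ 2 μ) :=
  (LinearMap.range (dualLp hY)).topologicalClosure

instance {Y : Ω → F} (hY : MemLp Y 2 μ) : CompleteSpace (dualSpan hY) :=
  Submodule.topologicalClosure.completeSpace _

theorem dualLp_mem_dualSpan {Y : Ω → F} (hY : MemLp Y 2 μ) (f' : StrongDual ℝ F) :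
    dualLp hY f' ∈ dualSpan hY :=
  Submodule.le_topologicalClosure _ ⟨f', rfl⟩

-- Events of `σ(Y)` thus have the form `Y ⁻¹' B`, so independence from `Y` applies to them.
omit [MeasurableSpace Ω] in
theorem sigmaOf_le_comap [MeasurableSpace F] [BorelSpace F] (Y : Ω → F) :
    sigmaOf Y ≤ MeasurableSpace.comap Y inferInstance := by
  refine iSup_le fun f' => ?_
  have : (fun ω => f' (Y ω)) = f' ∘ Y := rfl
  rw [this, ← MeasurableSpace.comap_comp, ← BorelSpace.measurable_eq (α := ℝ)]
  exact MeasurableSpace.comap_mono f'.measurable.comap_le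

theorem sigmaOf_le [MeasurableSpace F] [BorelSpace F] {Y : Ω → F} (hY : Measurable Y) :
    sigmaOf Y ≤ ‹MeasurableSpace Ω› :=
  (sigmaOf_le_comap Y).trans hY.comap_le

theorem aestronglyMeasurable_of_mem_dualSpan [MeasurableSpace F] [BorelSpace F] {Y : Ω → F}
    (hYm : Measurable Y) (hY : MemLp Y 2 μ) {u : Lp ℝ 2 μ} (hu : u ∈ dualSpan hY) :
    AEStronglyMeasurable[sigmaOf Y] u μ := by
  refine closure_minimal (s := (LinearMap.range (dualLp hY) : Set (Lp ℝ 2 μ))) ?_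
    (isClosed_aestronglyMeasurable (sigmaOf_le hYm)) hu
  rintro _ ⟨f', rfl⟩
  have : @Measurable _ _ (sigmaOf Y) _ fun ω => f' (Y ω) := by
    rw [measurable_iff_comap_le, BorelSpace.measurable_eq (α := ℝ)]
    exact le_iSup (fun f' : StrongDual ℝ F =>
      MeasurableSpace.comap (fun ω => f' (Y ω)) (borel ℝ)) f'
  exact this.stronglyMeasurable.aestronglyMeasurable.congr (coeFn_dualLp hY f').symm

theorem hasGaussianLaw_of_mem_dualSpan [IsProbabilityMeasure μ] [MeasurableSpace E] [BorelSpace E]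
    {X : Ω → E} (hX : MemLp X 2 μ) (hG : HasGaussianLaw X μ) {u : Lp ℝ 2 μ}
    (hu : u ∈ dualSpan hX) : HasGaussianLaw u μ := by
  refine closure_minimal (s := (LinearMap.range (dualLp hX) : Set (Lp ℝ 2 μ))) ?_
    isClosed_hasGaussianLaw hu
  rintro _ ⟨e', rfl⟩
  exact (hG.map_fun e').congr (coeFn_dualLp hX e').symm

theorem integral_eq_zero_of_mem_dualSpan [IsProbabilityMeasure μ] [CompleteSpace E] {X : Ω → E}
    (hX : MemLp X 2 μ) (hX0 : ∫ ω, X ω ∂μ = 0) {u : Lp ℝ 2 μ} (hu : u ∈ dualSpan hX) :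
    ∫ ω, u ω ∂μ = 0 := by
  refine closure_minimal (s := (LinearMap.range (dualLp hX) : Set (Lp ℝ 2 μ)))
    (t := {u | ∫ ω, u ω ∂μ = 0}) ?_
    (isClosed_eq continuous_integral_Lp_two continuous_const) hu
  rintro _ ⟨e', rfl⟩
  rw [Set.mem_ofPred_eq, integral_congr_ae (coeFn_dualLp hX e'),
    e'.integral_comp_comm (hX.integrable one_le_two), hX0, map_zero]

theorem dualSpan_comp_le {X : Ω → E} (hX : MemLp X 2 μ) (L : E →L[ℝ] F)
    {Y : Ω → F} (hY : MemLp Y 2 μ) (h : ∀ ω, L (X ω) = Y ω) : dualSpan hY ≤ dualSpan hX := by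
  refine Submodule.topologicalClosure_mono ?_
  rintro _ ⟨f', rfl⟩
  refine ⟨f'.comp L, ?_⟩
  refine Lp.ext ?_
  filter_upwards [coeFn_dualLp hX (f'.comp L), coeFn_dualLp hY f'] with ω h1 h2
  rw [h1, h2, ← h]
  rfl

end Projection

/-! ### Independence of the residual from `Y` -/

section Independence

variable {Ω E F : Type*} [MeasurableSpace Ω] {μ : Measure Ω} [IsProbabilityMeasure μ]
  [NormedAddCommGroup E] [NormedSpace ℝ E] [CompleteSpace E] [SecondCountableTopology E]
  [MeasurableSpace E] [BorelSpace E]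
  [NormedAddCommGroup F] [NormedSpace ℝ F] [CompleteSpace F] [SecondCountableTopology F]
  [MeasurableSpace F] [BorelSpace F] {X : Ω → E} {Y : Ω → F}

/-- The part of `e'(X)` that is orthogonal to all `f'(Y)`. -/
noncomputable def residual (hX : MemLp X 2 μ) (hY : MemLp Y 2 μ) (e' : StrongDual ℝ E) :
    Lp ℝ 2 μ :=
  dualLp hX e' - (dualSpan hY).starProjection (dualLp hX e')

omit [IsProbabilityMeasure μ] [CompleteSpace E] [SecondCountableTopology E] [MeasurableSpace E]
  [BorelSpace E] [CompleteSpace F] [SecondCountableTopology F] [MeasurableSpace F]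
  [BorelSpace F] in
theorem residual_mem_orthogonal (hX : MemLp X 2 μ) (hY : MemLp Y 2 μ) (e' : StrongDual ℝ E) :
    residual hX hY e' ∈ (dualSpan hY)ᗮ :=
  Submodule.sub_starProjection_mem_orthogonal _

/-- Every functional of the pair lies in the closed span of the functionals of `(X, Y)`, whose
elements are all Gaussian. -/
theorem hasGaussianLaw_residual_prod (hX : MemLp X 2 μ) (hY : MemLp Y 2 μ)
    (hYm : Measurable Y)
    (hXY : HasGaussianLaw (fun ω => (X ω, Y ω)) μ) (e' : StrongDual ℝ E) :
    HasGaussianLaw (fun ω => (residual hX hY e' ω, Y ω)) μ := by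
  have h2 : MemLp (fun ω => (X ω, Y ω)) 2 μ := hXY.memLp_two
  have hXle := dualSpan_comp_le h2 (.fst ℝ E F) hX fun _ => rfl
  have hYle := dualSpan_comp_le h2 (.snd ℝ E F) hY fun _ => rfl
  have hw : residual hX hY e' ∈ dualSpan h2 :=
    sub_mem (hXle (dualLp_mem_dualSpan hX e')) (hYle (Submodule.starProjection_apply_mem _ _))
  have hm : AEMeasurable (fun ω => (residual hX hY e' ω, Y ω)) μ :=
    (Lp.aestronglyMeasurable _).aemeasurable.prodMk hYm.aemeasurable
  refine ⟨isGaussian_of_isGaussian_map fun L => ?_⟩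
  rw [AEMeasurable.map_map_of_aemeasurable (by fun_prop) hm]
  refine HasGaussianLaw.isGaussian_map ?_
  -- A functional on `ℝ × F` has the form `(t, y) ↦ t * L (1, 0) + L (0, y)`.
  have hmem : L (1, 0) • residual hX hY e' + dualLp hY (L.comp (.inr ℝ ℝ F)) ∈ dualSpan h2 :=
    add_mem (Submodule.smul_mem _ _ hw) (hYle (dualLp_mem_dualSpan hY _))
  refine (hasGaussianLaw_of_mem_dualSpan h2 hXY hmem).congr ?_
  filter_upwards [Lp.coeFn_add (L (1, 0) • residual hX hY e') (dualLp hY (L.comp (.inr ℝ ℝ F))),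
    Lp.coeFn_smul (L (1, 0)) (residual hX hY e'), coeFn_dualLp hY (L.comp (.inr ℝ ℝ F))]
    with ω h1 h2 h3
  rw [h1, Pi.add_apply, h2, h3, Pi.smul_apply, Function.comp_apply]
  have : (residual hX hY e' ω, Y ω) = residual hX hY e' ω • ((1 : ℝ), (0 : F)) + (0, Y ω) := by
    simp
  rw [this, map_add, map_smul]
  simp [mul_comm]

theorem indepFun_residual (hX : MemLp X 2 μ) (hY : MemLp Y 2 μ) (hYm : Measurable Y)
    (hXY : HasGaussianLaw (fun ω => (X ω, Y ω)) μ)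
    (hY0 : ∫ ω, Y ω ∂μ = 0) (e' : StrongDual ℝ E) :
    IndepFun (residual hX hY e') Y μ := by
  refine (hasGaussianLaw_residual_prod hX hY hYm hXY e').indepFun_of_covariance_strongDual
    fun L₁ L₂ => ?_
  have hw := Lp.memLp (residual hX hY e')
  have hw' : MemLp (L₁ ∘ residual hX hY e') 2 μ := hw.continuousLinearMap_comp L₁
  have hY' : MemLp (L₂ ∘ Y) 2 μ := hY.continuousLinearMap_comp L₂
  rw [covariance_eq_sub hw' hY']
  have h0 : ∫ ω, (L₂ ∘ Y) ω ∂μ = 0 := by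
    simp only [Function.comp_apply]
    rw [L₂.integral_comp_comm (hY.integrable one_le_two), hY0, map_zero]
  rw [h0, mul_zero, sub_zero]
  have horth := (residual_mem_orthogonal hX hY e') _ (dualLp_mem_dualSpan hY L₂)
  rw [L2.inner_def] at horth
  rw [← mul_zero (L₁ 1), ← horth, ← integral_const_mul]
  refine integral_congr_ae ?_
  filter_upwards [coeFn_dualLp hY L₂] with ω hω
  have : L₁ (residual hX hY e' ω) = residual hX hY e' ω * L₁ 1 := by
    rw [← smul_eq_mul, ← map_smul, smul_eq_mul, mul_one]
  simp only [Pi.mul_apply, Function.comp_apply, hω, this, RCLike.inner_apply, conj_trivial]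
  ring

end Independence

/-- The indicator of `s` is a function of `Y`, so the expectation of its product with `w` factors.
-/
theorem setIntegral_of_indepFun {Ω F : Type*} [MeasurableSpace Ω] {μ : Measure Ω}
    [MeasurableSpace F] {Y : Ω → F} (hY : Measurable Y) {w : Ω → ℝ}
    (hw : AEStronglyMeasurable w μ) (h : IndepFun w Y μ) {s : Set Ω}
    (hs : MeasurableSet[MeasurableSpace.comap Y inferInstance] s) :
    ∫ ω in s, w ω ∂μ = μ.real s * ∫ ω, w ω ∂μ := by
  obtain ⟨B, hB, rfl⟩ := hs
  have hm : Measurable (B.indicator fun _ => (1 : ℝ)) := measurable_const.indicator hB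
  have h1 : IndepFun ((B.indicator fun _ => (1 : ℝ)) ∘ Y) w μ :=
    (h.comp measurable_id hm).symm
  have h2 := h1.integral_fun_mul_eq_mul_integral (hm.comp hY).aestronglyMeasurable hw
  have h3 : ∀ ω, ((B.indicator fun _ => (1 : ℝ)) ∘ Y) ω = (Y ⁻¹' B).indicator 1 ω := fun _ => rfl
  simp_rw [h3] at h2
  rw [integral_indicator_one (hY hB)] at h2
  rw [← h2, ← integral_indicator (hY hB)]
  refine integral_congr_ae (ae_of_all _ fun ω => ?_)
  by_cases hω : ω ∈ Y ⁻¹' B <;> simp [hω]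

/-! ### Testing tensors and covariances against pairs of functionals -/

section Tensor

variable {E : Type*} [NormedAddCommGroup E] [NormedSpace ℝ E]

theorem continuous_tmul : Continuous fun p : E × E => tmul p.1 p.2 := by
  refine Continuous.subtype_mk ?_ _
  have h : (fun p : E × E => elemTensor p.1 p.2) = fun p => ContinuousLinearMap.smulRightL ℝ
      (StrongDual ℝ E) E (ContinuousLinearMap.apply ℝ ℝ p.1) p.2 := rfl
  rw [h]
  fun_prop

theorem norm_tmul_le (x y : E) : ‖tmul x y‖ ≤ ‖x‖ * ‖y‖ := by
  refine ContinuousLinearMap.opNorm_le_bound _ (by positivity) fun e' => ?_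
  change ‖e' x • y‖ ≤ _
  rw [norm_smul]
  calc ‖e' x‖ * ‖y‖ ≤ (‖e'‖ * ‖x‖) * ‖y‖ := by gcongr; exact e'.le_opNorm x
    _ = _ := by ring

/-- The functional `T ↦ f'(T e')` on the injective tensor product. -/
noncomputable def evalPair (e' f' : StrongDual ℝ E) : injTensor E →L[ℝ] ℝ :=
  f'.comp ((ContinuousLinearMap.apply ℝ E e').comp (injTensor E).subtypeL)

theorem evalPair_apply (e' f' : StrongDual ℝ E) (T : injTensor E) :
    evalPair e' f' T = f' ((T : StrongDual ℝ E →L[ℝ] E) e') := rfl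

theorem evalPair_tmul (e' f' : StrongDual ℝ E) (x y : E) :
    evalPair e' f' (tmul x y) = e' x * f' y := by
  rw [evalPair_apply, show (tmul x y : StrongDual ℝ E →L[ℝ] E) = elemTensor x y from rfl,
    elemTensor_apply, map_smul, smul_eq_mul]

theorem ext_dual {S T : StrongDual ℝ E →L[ℝ] E} (h : ∀ e' f' : StrongDual ℝ E,
    f' (S e') = f' (T e')) : S = T := by
  ext e'
  exact (SeparatingDual.eq_iff_forall_dual_eq (R := ℝ)).2 fun f' => h e' f'

variable {Ω : Type*} [MeasurableSpace Ω] {μ : Measure Ω}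

theorem integrable_tmul_self {W : Ω → E} (hW : MemLp W 2 μ) :
    Integrable (fun ω => tmul (W ω) (W ω)) μ := by
  refine (hW.integrable_norm_pow (p := 2) two_ne_zero).mono' ?_ (ae_of_all _ fun ω => ?_)
  · exact continuous_tmul.comp_aestronglyMeasurable
      (hW.aestronglyMeasurable.prodMk hW.aestronglyMeasurable)
  · rw [pow_two]
    exact norm_tmul_le _ _

theorem integrable_dual_mul {X : Ω → E} (hX : MemLp X 2 μ) (e' f' : StrongDual ℝ E) :
    Integrable (fun ω => e' (X ω) * f' (X ω)) μ :=
  (hX.continuousLinearMap_comp e').integrable_mul (hX.continuousLinearMap_comp f')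

theorem dual_cov [CompleteSpace E] {X : Ω → E} (hX : MemLp X 2 μ) (e' f' : StrongDual ℝ E) :
    f' (cov hX e') = ∫ ω, e' (X ω) * f' (X ω) ∂μ := by
  rw [cov_apply, ← f'.integral_comp_comm (integrable_dual_smul hX e')]
  simp only [map_smul, smul_eq_mul]

theorem dual_cov_eq_inner [CompleteSpace E] {X : Ω → E} (hX : MemLp X 2 μ)
    (e' f' : StrongDual ℝ E) {u v : Lp ℝ 2 μ} (hu : (fun ω => e' (X ω)) =ᵐ[μ] u)
    (hv : (fun ω => f' (X ω)) =ᵐ[μ] v) : f' (cov hX e') = ⟪u, v⟫ := by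
  rw [dual_cov, L2.inner_def]
  refine integral_congr_ae ?_
  filter_upwards [hu, hv] with ω h1 h2
  simp only [h1, h2, RCLike.inner_apply, conj_trivial, mul_comm]

theorem cov_comp [CompleteSpace E] {F : Type*} [NormedAddCommGroup F] [NormedSpace ℝ F]
    [CompleteSpace F] {Y : Ω → F} {Z : Ω → E} (hY : MemLp Y 2 μ) (hZ : MemLp Z 2 μ)
    (M : F →L[ℝ] E) (h : ∀ᵐ ω ∂μ, M (Y ω) = Z ω) :
    cov hZ = M ∘L cov hY ∘L ContinuousLinearMap.precomp ℝ M := by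
  ext e'
  rw [cov_apply]
  change _ = M (cov hY (e'.comp M))
  rw [cov_apply, ← M.integral_comp_comm (integrable_dual_smul hY _)]
  refine integral_congr_ae ?_
  filter_upwards [h] with ω hω
  rw [map_smul, ContinuousLinearMap.comp_apply, hω]

end Tensor

/-! ### The conditional mean and the conditional variance -/

section Conditional

variable {Ω E F : Type*} [MeasurableSpace Ω] {μ : Measure Ω} [IsProbabilityMeasure μ]
  [NormedAddCommGroup E] [NormedSpace ℝ E] [CompleteSpace E] [SecondCountableTopology E]
  [MeasurableSpace E] [BorelSpace E]
  [NormedAddCommGroup F] [NormedSpace ℝ F] [CompleteSpace F] [SecondCountableTopology F]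
  [MeasurableSpace F] [BorelSpace F] {X : Ω → E} {Y : Ω → F}

/-- `e'(𝔼(X|Y))` is the orthogonal projection of `e'(X)` onto the span of the `f'(Y)`. -/
theorem dual_condMean_ae_eq (hX : MemLp X 2 μ) (hY : MemLp Y 2 μ) (hYm : Measurable Y)
    (hXY : HasGaussianLaw (fun ω => (X ω, Y ω)) μ)
    (hX0 : ∫ ω, X ω ∂μ = 0) (hY0 : ∫ ω, Y ω ∂μ = 0) (e' : StrongDual ℝ E) :
    (fun ω => e' (condMean X Y μ ω)) =ᵐ[μ] (dualSpan hY).starProjection (dualLp hX e') := by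
  set u := (dualSpan hY).starProjection (dualLp hX e') with hu
  have hmem : u ∈ dualSpan hY := Submodule.starProjection_apply_mem _ _
  have hm := sigmaOf_le hYm
  have hXi := hX.integrable one_le_two
  have hres : residual hX hY e' =ᵐ[μ] fun ω => e' (X ω) - u ω := by
    filter_upwards [Lp.coeFn_sub (dualLp hX e') u, coeFn_dualLp hX e'] with ω h1 h2
    rw [residual, ← hu, h1, Pi.sub_apply, h2]
  have h0 : ∫ ω, residual hX hY e' ω ∂μ = 0 := by
    rw [integral_congr_ae hres, integral_sub (e'.integrable_comp hXi) (integrable_Lp_two u),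
      integral_eq_zero_of_mem_dualSpan hY hY0 hmem, e'.integral_comp_comm hXi, hX0, map_zero,
      sub_zero]
  refine (ContinuousLinearMap.comp_condExp_comm hXi e').trans
    (ae_eq_condExp_of_forall_setIntegral_eq hm (e'.integrable_comp hXi)
      (fun s _ _ => (integrable_Lp_two u).integrableOn) (fun s hs _ => ?_)
      (aestronglyMeasurable_of_mem_dualSpan hYm hY hmem)).symm
  -- Independence and zero mean make the residual integrate to zero over each event of `σ(Y)`.
  have h1 := setIntegral_of_indepFun hYm (Lp.aestronglyMeasurable _)
    (indepFun_residual hX hY hYm hXY hY0 e') (sigmaOf_le_comap Y s hs)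
  rw [h0, mul_zero, integral_congr_ae (ae_restrict_of_ae hres),
    integral_sub (e'.integrable_comp hXi).integrableOn (integrable_Lp_two u).integrableOn,
    sub_eq_zero] at h1
  exact h1.symm

theorem dual_sub_condMean_ae_eq (hX : MemLp X 2 μ) (hY : MemLp Y 2 μ) (hYm : Measurable Y)
    (hXY : HasGaussianLaw (fun ω => (X ω, Y ω)) μ)
    (hX0 : ∫ ω, X ω ∂μ = 0) (hY0 : ∫ ω, Y ω ∂μ = 0) (e' : StrongDual ℝ E) :
    (fun ω => e' (X ω - condMean X Y μ ω)) =ᵐ[μ] residual hX hY e' := by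
  filter_upwards [dual_condMean_ae_eq hX hY hYm hXY hX0 hY0 e', coeFn_dualLp hX e',
    Lp.coeFn_sub (dualLp hX e') ((dualSpan hY).starProjection (dualLp hX e'))] with ω h1 h2 h3
  rw [residual, h3, Pi.sub_apply, map_sub, h1, h2]

theorem setIntegral_dual_mul (hX : MemLp X 2 μ) (hY : MemLp Y 2 μ) (hYm : Measurable Y)
    (hXY : HasGaussianLaw (fun ω => (X ω, Y ω)) μ)
    (hX0 : ∫ ω, X ω ∂μ = 0) (hY0 : ∫ ω, Y ω ∂μ = 0)
    (hW : MemLp (fun ω => X ω - condMean X Y μ ω) 2 μ) (e' f' : StrongDual ℝ E)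
    {s : Set Ω} (hs : MeasurableSet[sigmaOf Y] s) :
    ∫ ω in s, e' (X ω - condMean X Y μ ω) * f' (X ω - condMean X Y μ ω) ∂μ =
      μ.real s * ∫ ω, e' (X ω - condMean X Y μ ω) * f' (X ω - condMean X Y μ ω) ∂μ := by
  set W := fun ω => X ω - condMean X Y μ ω
  have hsq : ∀ g' : StrongDual ℝ E,
      ∫ ω in s, g' (W ω) * g' (W ω) ∂μ = μ.real s * ∫ ω, g' (W ω) * g' (W ω) ∂μ := by
    intro g'
    have hae : (fun ω => g' (W ω) * g' (W ω)) =ᵐ[μ]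
        fun ω => residual hX hY g' ω * residual hX hY g' ω := by
      filter_upwards [dual_sub_condMean_ae_eq hX hY hYm hXY hX0 hY0 g'] with ω h
      rw [h]
    rw [integral_congr_ae (ae_restrict_of_ae hae), integral_congr_ae hae]
    have hm := Lp.aestronglyMeasurable (residual hX hY g')
    refine setIntegral_of_indepFun hYm (hm.mul hm) ?_ (sigmaOf_le_comap Y s hs)
    exact (indepFun_residual hX hY hYm hXY hY0 g').comp (φ := fun x => x * x) (ψ := id)
      (by fun_prop) measurable_id
  -- Independence from `Y` was shown for one residual at a time, not for pairs; polarization reduces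
  -- products to squares.
  have hpol : ∀ ω, e' (W ω) * f' (W ω) = (1 / 4) * ((e' + f') (W ω) * (e' + f') (W ω) -
      (e' - f') (W ω) * (e' - f') (W ω)) := by
    intro ω
    simp only [add_apply, sub_apply]
    ring
  have h1 := integrable_dual_mul hW (e' + f') (e' + f')
  have h2 := integrable_dual_mul hW (e' - f') (e' - f')
  change ∫ ω in s, e' (W ω) * f' (W ω) ∂μ = μ.real s * ∫ ω, e' (W ω) * f' (W ω) ∂μ
  simp_rw [hpol]
  rw [integral_const_mul, integral_const_mul, integral_sub h1 h2,
    integral_sub h1.integrableOn h2.integrableOn, hsq, hsq]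
  ring

/-- The conditional variance of `X` given `Y` is almost surely constant. -/
theorem condCov_ae_eq_const (hX : MemLp X 2 μ) (hY : MemLp Y 2 μ) (hYm : Measurable Y)
    (hXY : HasGaussianLaw (fun ω => (X ω, Y ω)) μ)
    (hX0 : ∫ ω, X ω ∂μ = 0) (hY0 : ∫ ω, Y ω ∂μ = 0)
    (hW : MemLp (fun ω => X ω - condMean X Y μ ω) 2 μ) :
    condCov X Y μ =ᵐ[μ] fun _ =>
      ∫ ω, tmul (X ω - condMean X Y μ ω) (X ω - condMean X Y μ ω) ∂μ := by
  have hV := integrable_tmul_self hW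
  refine (ae_eq_condExp_of_forall_setIntegral_eq (sigmaOf_le hYm) hV
    (fun s _ _ => integrableOn_const (measure_ne_top μ s)) (fun s hs _ => ?_)
    stronglyMeasurable_const.aestronglyMeasurable).symm
  rw [setIntegral_const]
  refine Subtype.ext (ext_dual fun e' f' => ?_)
  rw [← evalPair_apply, ← evalPair_apply, map_smul,
    ← ContinuousLinearMap.integral_comp_comm _ hV,
    ← ContinuousLinearMap.integral_comp_comm _ hV.integrableOn]
  simp_rw [evalPair_tmul]
  exact (setIntegral_dual_mul hX hY hYm hXY hX0 hY0 hW e' f' hs).symm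

theorem integral_tmul_eq_cov_sub_cov (hX : MemLp X 2 μ) (hY : MemLp Y 2 μ) (hYm : Measurable Y)
    (hXY : HasGaussianLaw (fun ω => (X ω, Y ω)) μ)
    (hX0 : ∫ ω, X ω ∂μ = 0) (hY0 : ∫ ω, Y ω ∂μ = 0) (hZ : MemLp (condMean X Y μ) 2 μ)
    (hW : MemLp (fun ω => X ω - condMean X Y μ ω) 2 μ) :
    ((∫ ω, tmul (X ω - condMean X Y μ ω) (X ω - condMean X Y μ ω) ∂μ : injTensor E) :
      StrongDual ℝ E →L[ℝ] E) = cov hX - cov hZ := by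
  refine ext_dual fun e' f' => ?_
  rw [← evalPair_apply, ← ContinuousLinearMap.integral_comp_comm _ (integrable_tmul_self hW)]
  simp_rw [evalPair_tmul]
  rw [← dual_cov hW, sub_apply, map_sub,
    dual_cov_eq_inner hX e' f' (coeFn_dualLp hX e').symm (coeFn_dualLp hX f').symm,
    dual_cov_eq_inner hZ e' f' (dual_condMean_ae_eq hX hY hYm hXY hX0 hY0 e')
      (dual_condMean_ae_eq hX hY hYm hXY hX0 hY0 f'),
    dual_cov_eq_inner hW e' f' (dual_sub_condMean_ae_eq hX hY hYm hXY hX0 hY0 e')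
      (dual_sub_condMean_ae_eq hX hY hYm hXY hX0 hY0 f')]
  have hp : ∀ g' : StrongDual ℝ E, dualLp hX g' =
      (dualSpan hY).starProjection (dualLp hX g') + residual hX hY g' := fun g' => by
    rw [residual, add_sub_cancel]
  have hP : ∀ g' : StrongDual ℝ E, (dualSpan hY).starProjection (dualLp hX g') ∈ dualSpan hY :=
    fun g' => Submodule.starProjection_apply_mem _ _
  -- The cross terms between projections and residuals vanish.
  have h1 := Submodule.inner_right_of_mem_orthogonal (hP e') (residual_mem_orthogonal hX hY f')
  have h2 := Submodule.inner_left_of_mem_orthogonal (hP f') (residual_mem_orthogonal hX hY e')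
  conv_rhs => enter [1]; rw [hp e', hp f', inner_add_left, inner_add_right, inner_add_right, h1, h2]
  ring

end Conditional

end GaussCond

theorem mainTheorem4 {Ω E F : Type*} [MeasurableSpace Ω]
    [NormedAddCommGroup E] [NormedSpace ℝ E] [CompleteSpace E] [SeparableSpace E]
    [MeasurableSpace E] [BorelSpace E]
    [NormedAddCommGroup F] [NormedSpace ℝ F] [CompleteSpace F] [SeparableSpace F]
    [MeasurableSpace F] [BorelSpace F]
    (μ : Measure Ω) [IsProbabilityMeasure μ] (X : Ω → E) (Y : Ω → F)
    (hX : Measurable X) (hY : Measurable Y)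
    (hXY : HasGaussianLaw (fun ω => (X ω, Y ω)) μ)
    (hX0 : ∫ ω, X ω ∂μ = 0) (hY0 : ∫ ω, Y ω ∂μ = 0) :
    ∃ (h2X : MemLp X 2 μ) (h2Y : MemLp Y 2 μ) (h2Z : MemLp (GaussCond.condMean X Y μ) 2 μ),
      (∀ᵐ ω ∂μ, (GaussCond.condCov X Y μ ω : StrongDual ℝ E →L[ℝ] E) =
        GaussCond.cov h2X - GaussCond.cov h2Z) ∧
      ∀ M : F →L[ℝ] E, (∀ᵐ ω ∂μ, M (Y ω) = GaussCond.condMean X Y μ ω) →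
        ∀ᵐ ω ∂μ, (GaussCond.condCov X Y μ ω : StrongDual ℝ E →L[ℝ] E) =
          GaussCond.cov h2X - M ∘L GaussCond.cov h2Y ∘L ContinuousLinearMap.precomp ℝ M := by
  have : SecondCountableTopology E := UniformSpace.secondCountable_of_separable E
  have : SecondCountableTopology F := UniformSpace.secondCountable_of_separable F
  have h2X : MemLp X 2 μ := hXY.fst.memLp_two
  have h2Y : MemLp Y 2 μ := hXY.snd.memLp_two
  have h2Z : MemLp (GaussCond.condMean X Y μ) 2 μ := h2X.condExp one_le_two
  have hW : MemLp (fun ω => X ω - GaussCond.condMean X Y μ ω) 2 μ := h2X.sub h2Z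
  have key : ∀ᵐ ω ∂μ, (GaussCond.condCov X Y μ ω : StrongDual ℝ E →L[ℝ] E) =
      GaussCond.cov h2X - GaussCond.cov h2Z := by
    filter_upwards [GaussCond.condCov_ae_eq_const h2X h2Y hY hXY hX0 hY0 hW] with ω hω
    rw [hω, GaussCond.integral_tmul_eq_cov_sub_cov h2X h2Y hY hXY hX0 hY0 h2Z hW]
  refine ⟨h2X, h2Y, h2Z, key, fun M hM => ?_⟩
  rw [← GaussCond.cov_comp h2Y h2Z M hM]
  exact key
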